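/- Let $n\ge 1$ and let $\omega=\sum_{i=1}^n dx_i\wedge dy_i$ be the standard symplectic form on $\mathbb R^{2n}$. Let \[ \mathcal U(n)=\Bigl\{\Omega\in\mathbb C\otimes{\textstyle\bigwedge}^{n}(\mathbb R^{2n})^*\ \Big|\ \Omega\wedge\omega=0,\ \Omega|_L\neq 0\text{ for every Lagrangian subspace }L\subset\mathbb R^{2n}\Bigr\}. \] The group $\mathrm{Sp}(2n,\mathbb R)\times\mathrm{SL}(2,\mathbb R)$ acts on the finite-dimensional real vector space $\mathbb C\otimes\bigwedge^n(\mathbb R^{2n})^*$ by $(g,h)\cdot\Omega=h\circ\Omega(g^{-1}\cdot,\ldots,g^{-1}\cdot)$, where $\mathrm{SL}(2,\mathbb R)$ acts on the values via $\mathbb C=\mathbb R^2$. Then for every $\Omega\in\mathcal U(n)$ the orbit of $\Omega$ under $\mathrm{Sp}(2n,\mathbb R)\times\mathrm{SL}(2,\mathbb R)$ is a closed subset of $\mathbb C\otimes\bigwedge^n(\mathbb R^{2n})^*$. -/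

import Mathlib

namespace SympForms

open Matrix

/-- The real vector space `ℝ²ⁿ` with coordinates `x_i = v (inl i)` and `y_i = v (inr i)`;
as `ℂⁿ` it has the complex coordinates `z_i = x_i + i y_i`. -/
abbrev Space (n : ℕ) : Type := Fin n ⊕ Fin n → ℝ

/-- The standard symplectic form `ω = ∑ i, dx_i ∧ dy_i` on `ℝ²ⁿ`. -/
def symplecticForm (n : ℕ) : Space n [⋀^Fin 2]→ₗ[ℝ] ℝ where
  toFun v := ∑ i : Fin n, (v 0 (Sum.inl i) * v 1 (Sum.inr i) - v 0 (Sum.inr i) * v 1 (Sum.inl i))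
  map_update_add' v j x y := by
    fin_cases j <;>
      simp [Function.update, -Finset.sum_sub_distrib,
        ← Finset.sum_add_distrib] <;>
      exact Finset.sum_congr rfl fun i _ => by ring
  map_update_smul' v j c x := by
    fin_cases j <;> simp [Function.update, Finset.mul_sum, -Finset.sum_sub_distrib] <;>
      exact Finset.sum_congr rfl fun i _ => by ring
  map_eq_zero_of_eq' v i j h hij := by
    have h01 : v 0 = v 1 := by
      fin_cases i <;> fin_cases j <;> simp_all
    simp [h01, mul_comm]

/-- Complex-valued real-multilinear alternating `n`-forms on `ℝ²ⁿ`, i.e. `ℂ ⊗ ⋀ⁿ(ℝ²ⁿ)*`,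
with its topology of a finite-dimensional real vector space. -/
abbrev Form (n : ℕ) : Type := Space n [⋀^Fin n]→L[ℝ] ℂ

/-- The wedge product of a complex-valued and a real-valued form (the sum over shuffles). -/
noncomputable def wedge {E : Type*} [AddCommGroup E] [Module ℝ E] {m k : ℕ}
    (a : E [⋀^Fin m]→ₗ[ℝ] ℂ) (b : E [⋀^Fin k]→ₗ[ℝ] ℝ) : E [⋀^Fin (m + k)]→ₗ[ℝ] ℂ :=
  ((TensorProduct.rid ℝ ℂ).toLinearMap.compAlternatingMap (a.domCoprod b)).domDomCongr
    finSumFinEquiv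

/-- Lagrangian subspaces of `(ℝ²ⁿ, ω)`: isotropic of dimension `n`. -/
def IsLagrangian {n : ℕ} (L : Submodule ℝ (Space n)) : Prop :=
  Module.finrank ℝ L = n ∧ ∀ x ∈ L, ∀ y ∈ L, symplecticForm n ![x, y] = 0

/-- The set `𝒰(n)` of primitive complex-valued `n`-forms that restrict to a non-zero form on
every Lagrangian subspace. -/
def U (n : ℕ) : Set (Form n) :=
  {Ω | wedge Ω.toAlternatingMap (symplecticForm n) = 0 ∧
    ∀ L : Submodule ℝ (Space n), IsLagrangian L → Ω.compContinuousLinearMap L.subtypeL ≠ 0}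

/-- `SL(2,ℝ)`, as a group. -/
abbrev SL2 : Type := SpecialLinearGroup (Fin 2) ℝ

/-- The symplectic group `Sp(2n,ℝ)`, as a group. -/
abbrev Sp (n : ℕ) : Type := symplecticGroup (Fin n) ℝ

/-- The action of a symplectic matrix on `ℝ²ⁿ` (matrix times column vector). -/
noncomputable def spMap {n : ℕ} (g : Sp n) : Space n →L[ℝ] Space n :=
  LinearMap.toContinuousLinearMap (Matrix.toLin' g.1)

/-- The action of a real `2 × 2` matrix on `ℂ = ℝ²`, with respect to the basis `1, i`. -/
noncomputable def slMap (h : SL2) : ℂ →L[ℝ] ℂ :=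
  LinearMap.toContinuousLinearMap (Matrix.toLin Complex.basisOneI Complex.basisOneI h.1)

/-- The action of `Sp(2n,ℝ) × SL(2,ℝ)` on forms: `(g, h) • Ω = h ∘ (g⁻¹)^* Ω`. -/
noncomputable instance formAction (n : ℕ) : MulAction (Sp n × SL2) (Form n) where
  smul p Ω := (slMap p.2).compContinuousAlternatingMap (Ω.compContinuousLinearMap (spMap p.1⁻¹))
  one_smul Ω := by
    ext v
    change slMap 1 (Ω (spMap (1 : Sp n)⁻¹ ∘ v)) = Ω v
    have h1 : ⇑(spMap (1 : Sp n)⁻¹) ∘ v = v := by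
      funext i; simp [spMap]
    rw [h1]; simp [slMap]
  mul_smul p q Ω := by
    ext v
    change slMap (p.2 * q.2) (Ω (spMap (p.1 * q.1)⁻¹ ∘ v)) =
      slMap p.2 (slMap q.2 (Ω (spMap q.1⁻¹ ∘ (spMap p.1⁻¹ ∘ v))))
    have h1 : ⇑(spMap (p.1 * q.1)⁻¹) ∘ v = spMap q.1⁻¹ ∘ (spMap p.1⁻¹ ∘ v) := by
      funext i; simp [spMap, _root_.mul_inv_rev, Matrix.mulVec_mulVec]
    rw [h1]
    simp [slMap, Matrix.toLin_mul Complex.basisOneI Complex.basisOneI Complex.basisOneI]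

end SympForms

/-!
The area form `a ∧ b` on `ℂ = ℝ²` is invariant under `SL(2,ℝ)`. For a symplectic matrix `V` and an
index `j`, `frameArea Ω V j` is the area spanned by the values of `Ω` on the Lagrangian frames
`V ∂/∂x_1, …, V ∂/∂x_n` and the same frame with `V ∂/∂x_j` replaced by `V ∂/∂y_j`. All
non-trivial combinations of the two are again Lagrangian frames, so for `Ω ∈ 𝒰(n)` the two values
are linearly independent over `ℝ` and the area is non-zero (`frameArea_ne_zero`). By compactness it
is bounded away from zero for `V` orthogonal and symplectic.

Write a symplectic `G` in Cartan form `G U = V diag(t, t⁻¹)` with `U`, `V` orthogonal symplectic and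
`t ≥ 1` (`exists_cartan_decomposition`). Then the area of `h ∘ Ω(G ·)` on `U` is
`∏_{i ≠ j} t_i²` times the area of `Ω` on `V` (`frameArea_transform`), independently of `h`. If
`n ≥ 2`, a bound on `h ∘ Ω(G ·)` therefore bounds every `t_i`, hence `G`
(`exists_bound_of_norm_transform_le`). So, for a convergent sequence `h_k ∘ Ω(G_k ·)` in the orbit,
a subsequence of `G_k` converges to a symplectic matrix; moving `G_k` to the other side, `h_k ∘ Ω`
converges as well, and its limit is of the form `h ∘ Ω` because the values of `Ω` span `ℂ`
(`exists_slMap_comp_eq_of_tendsto`).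

For `n = 1` stabilizers are not compact, and the argument is different: `Ω` is an invertible linear
map `ℝ² → ℝ²`, and its orbit is the set of maps with the same determinant (`mem_orbit_iff_of_one`).
-/

namespace SympForms

open Matrix Filter Topology
open scoped RealInnerProductSpace

/-! ### Cartan decomposition of the symplectic group -/

/-- Spectral theorem adapted to a complex structure `j`: a positive operator `T` with `T j T = j`
has an orthonormal family of eigenvectors with eigenvalues at least `1`, orthogonal to its image
under `j`, of any length `k` up to half the dimension. The family is extended one vector at a time:
the orthogonal complement of the vectors found and of their images under `j` is invariant under `T`
and `j`, and if `v` is an eigenvector for `μ`, then `j v` is one for `μ⁻¹`, so that one of the two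
eigenvalues is at least `1`. -/
theorem exists_orthonormal_eigenframe {E : Type*} [NormedAddCommGroup E] [InnerProductSpace ℝ E]
    [FiniteDimensional ℝ E] {T j : E →ₗ[ℝ] E} (hT : T.IsSymmetric)
    (hpos : ∀ x, x ≠ 0 → 0 < ⟪T x, x⟫) (hj : ∀ x, j (j x) = -x)
    (hskew : ∀ x y, ⟪j x, y⟫ = -⟪x, j y⟫) (hTj : ∀ x, T (j (T x)) = j x) (k : ℕ)
    (hk : 2 * k ≤ Module.finrank ℝ E) :
    ∃ (e : Fin k → E) (s : Fin k → ℝ), (∀ i, 1 ≤ s i) ∧ (∀ i, T (e i) = s i • e i) ∧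
      Orthonormal ℝ e ∧ ∀ i l, ⟪e i, j (e l)⟫ = 0 := by
  induction k with
  | zero => exact ⟨Fin.elim0, Fin.elim0, fun i => i.elim0, fun i => i.elim0,
      ⟨fun i => i.elim0, fun i => i.elim0⟩, fun i => i.elim0⟩
  | succ k ih =>
    obtain ⟨e, s, hs, he, heo, hej⟩ := ih (by omega)
    have hTje : ∀ i, s i • T (j (e i)) = j (e i) := fun i => by
      rw [← map_smul, ← map_smul, ← he i, hTj]
    have hjn : ∀ x, ‖j x‖ = ‖x‖ := fun x => by
      have h : ⟪j x, j x⟫ = ⟪x, x⟫ := by rw [hskew, hj]; simp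
      rw [real_inner_self_eq_norm_sq, real_inner_self_eq_norm_sq] at h
      exact (sq_eq_sq₀ (norm_nonneg _) (norm_nonneg _)).1 h
    let K : Submodule ℝ E := Submodule.span ℝ (Set.range (Sum.elim e (j ∘ e)))
    have hmem : ∀ w, w ∈ Kᗮ ↔ (∀ i, ⟪e i, w⟫ = 0) ∧ ∀ i, ⟪j (e i), w⟫ = 0 := by
      intro w
      constructor
      · intro hw
        exact ⟨fun i => (Submodule.mem_orthogonal _ _).1 hw _
            (Submodule.subset_span ⟨Sum.inl i, rfl⟩),
          fun i => (Submodule.mem_orthogonal _ _).1 hw _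
            (Submodule.subset_span ⟨Sum.inr i, rfl⟩)⟩
      · rintro ⟨h1, h2⟩
        rw [Submodule.mem_orthogonal]
        intro u hu
        induction hu using Submodule.span_induction with
        | mem x hx =>
          obtain ⟨i | i, rfl⟩ := hx
          · exact h1 i
          · exact h2 i
        | zero => simp
        | add x y _ _ hx hy => rw [inner_add_left, hx, hy, add_zero]
        | smul a x _ hx => rw [real_inner_smul_left, hx, mul_zero]
    have hTW : ∀ w ∈ Kᗮ, T w ∈ Kᗮ := by
      intro w hw
      rw [hmem] at hw ⊢
      refine ⟨fun i => ?_, fun i => ?_⟩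
      · rw [← hT, he, real_inner_smul_left, hw.1, mul_zero]
      · have h := hw.2 i
        rw [← hTje i, real_inner_smul_left, hT] at h
        exact (mul_eq_zero.1 h).resolve_left (by linarith [hs i])
    have hjW : ∀ w ∈ Kᗮ, j w ∈ Kᗮ := by
      intro w hw
      rw [hmem] at hw ⊢
      refine ⟨fun i => ?_, fun i => ?_⟩
      · have := hskew (e i) w
        rw [hw.2 i] at this
        linarith
      · rw [hskew, hj, inner_neg_right, hw.1]; simp
    have hne : Kᗮ ≠ ⊥ := by
      intro h
      rw [Submodule.orthogonal_eq_bot_iff] at h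
      have h1 : Module.finrank ℝ K ≤ _ := finrank_range_le_card (Sum.elim e (j ∘ e))
      rw [h, finrank_top] at h1
      simp at h1
      omega
    obtain ⟨w, hwK, hw1, t, ht, hwt⟩ : ∃ w ∈ Kᗮ, ‖w‖ = 1 ∧ ∃ t : ℝ, 1 ≤ t ∧ T w = t • w := by
      have : Nontrivial Kᗮ := Submodule.nontrivial_iff_ne_bot.2 hne
      have hμ := (hT.restrict_invariant hTW).hasEigenvalue_iSup_of_finiteDimensional
      obtain ⟨v, hv⟩ := hμ.exists_hasEigenvector
      generalize (⨆ x : {x : Kᗮ // x ≠ 0}, _ : ℝ) = μ at hv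
      have hv0 : (v : E) ≠ 0 := fun h => hv.2 (Subtype.ext h)
      have hTv : T v = μ • (v : E) := congrArg Subtype.val hv.apply_eq_smul
      have hμ0 : 0 < μ := by
        have := hpos v hv0
        rw [hTv, real_inner_smul_left] at this
        exact pos_of_mul_pos_left this real_inner_self_nonneg
      obtain ⟨w, hwK, hw0, t, ht, hwt⟩ :
          ∃ w ∈ Kᗮ, w ≠ 0 ∧ ∃ t : ℝ, 1 ≤ t ∧ T w = t • w := by
        rcases le_total 1 μ with h | h
        · exact ⟨v, v.2, hv0, μ, h, hTv⟩
        · refine ⟨j v, hjW _ v.2, ?_, μ⁻¹, (one_le_inv₀ hμ0).2 h, ?_⟩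
          · rw [← norm_ne_zero_iff, hjn]; exact norm_ne_zero_iff.2 hv0
          · rw [eq_inv_smul_iff₀ hμ0.ne', ← map_smul, ← map_smul, ← hTv, hTj]
      refine ⟨‖w‖⁻¹ • w, Submodule.smul_mem _ _ hwK, norm_smul_inv_norm (𝕜 := ℝ) hw0, t, ht, ?_⟩
      rw [map_smul, hwt, smul_comm]
    have hw := (hmem w).1 hwK
    have hself : ∀ x, ⟪x, j x⟫ = 0 := fun x => by
      have := hskew x x
      rw [real_inner_comm] at this
      linarith
    refine ⟨Fin.cons w e, Fin.cons t s, ?_, ?_, ?_, ?_⟩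
    · intro i; cases i using Fin.cases <;> simp [ht, hs]
    · intro i; cases i using Fin.cases <;> simp [hwt, he]
    · rw [orthonormal_iff_ite] at heo ⊢
      intro i l
      cases i using Fin.cases <;> cases l using Fin.cases
      · simp [hw1]
      · rw [real_inner_comm]; simp [hw.1, (Fin.succ_ne_zero _).symm]
      · simp [hw.1]
      · simp [heo]
    · intro i l
      cases i using Fin.cases with
      | zero =>
        cases l using Fin.cases with
        | zero => simp [hself]
        | succ l => rw [real_inner_comm]; simp [hw.2]
      | succ i =>
        cases l using Fin.cases with
        | zero =>
          have := hskew (e i) w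
          rw [hw.2 i] at this
          simp; linarith
        | succ l => simp [hej]

/-- The diagonal matrix `diag(t, t⁻¹)`. -/
noncomputable def hyperbolic {n : ℕ} (t : Fin n → ℝ) : Matrix (Fin n ⊕ Fin n) (Fin n ⊕ Fin n) ℝ :=
  diagonal (Sum.elim t t⁻¹)

theorem hyperbolic_mem {n : ℕ} {t : Fin n → ℝ} (ht : ∀ i, t i ≠ 0) :
    hyperbolic t ∈ symplecticGroup (Fin n) ℝ := by
  rw [hyperbolic, ← fromBlocks_diagonal, SymplecticGroup.fromBlocks_mem_iff]
  simp [ht]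

theorem hyperbolic_mul {n : ℕ} (s t : Fin n → ℝ) :
    hyperbolic s * hyperbolic t = hyperbolic (s * t) := by
  rw [hyperbolic, hyperbolic, hyperbolic, diagonal_mul_diagonal]
  congr 1
  ext (i | i) <;> simp [mul_comm]

theorem hyperbolic_one {n : ℕ} : hyperbolic (1 : Fin n → ℝ) = 1 := by
  rw [hyperbolic, ← diagonal_one]
  congr 1
  ext (i | i) <;> simp

/-- The maximal compact subgroup `Sp(2n,ℝ) ∩ O(2n)`, as a set of matrices. -/
def orthogonalSymplectic (n : ℕ) : Set (Matrix (Fin n ⊕ Fin n) (Fin n ⊕ Fin n) ℝ) :=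
  {V | V ∈ symplecticGroup (Fin n) ℝ ∧ Vᵀ * V = 1}

/-- A positive definite symplectic matrix is diagonalized by a matrix that is both symplectic and
orthogonal. -/
theorem exists_diagonalization {n : ℕ} {P : Matrix (Fin n ⊕ Fin n) (Fin n ⊕ Fin n) ℝ}
    (hP : P.PosDef) (hPs : P ∈ symplecticGroup (Fin n) ℝ) :
    ∃ U ∈ orthogonalSymplectic n, ∃ s : Fin n → ℝ, (∀ i, 1 ≤ s i) ∧
      P * U = U * hyperbolic s := by
  have hPt : Pᵀ = P := by simpa [IsHermitian] using hP.isHermitian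
  have hJ2 : J (Fin n) ℝ * J (Fin n) ℝ = -1 := J_squared _ _
  have hPJ : P * J (Fin n) ℝ * P = J (Fin n) ℝ := by
    simpa [hPt] using SymplecticGroup.mem_iff.1 hPs
  have inner_eq : ∀ x y : EuclideanSpace ℝ (Fin n ⊕ Fin n), ⟪x, y⟫ = x.ofLp ⬝ᵥ y.ofLp := by
    intro x y
    rw [EuclideanSpace.inner_eq_star_dotProduct, dotProduct_comm]; simp
  obtain ⟨e, s, hs, he, heo, hej⟩ := exists_orthonormal_eigenframe
    (E := EuclideanSpace ℝ (Fin n ⊕ Fin n)) (T := P.toEuclideanLin)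
    (j := (J (Fin n) ℝ).toEuclideanLin) (isSymmetric_toEuclideanLin_iff.2 hP.isHermitian)
    (fun x hx => by
      rw [inner_eq, dotProduct_comm]
      have := hP.dotProduct_mulVec_pos (x := x.ofLp) (by simpa using hx)
      simpa [toLpLin_apply] using this)
    (fun x => by simp [toLpLin_apply, hJ2, neg_mulVec])
    (fun x y => by
      rw [inner_eq, inner_eq, dotProduct_comm]
      simp only [toLpLin_apply]
      rw [dotProduct_mulVec, ← mulVec_transpose, J_transpose, neg_mulVec, neg_dotProduct,
        dotProduct_comm])
    (fun x => by simp [toLpLin_apply, hPJ, ← Matrix.mul_assoc]) n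
    (by simp; omega)
  have he' : ∀ i, P *ᵥ (e i).ofLp = s i • (e i).ofLp := fun i => by
    simpa [toLpLin_apply] using congrArg WithLp.ofLp (he i)
  have heo' : ∀ i l, (e i).ofLp ⬝ᵥ (e l).ofLp = if i = l then 1 else 0 := fun i l => by
    rw [← inner_eq]; exact orthonormal_iff_ite.1 heo i l
  have hej' : ∀ i l, (e i).ofLp ⬝ᵥ (J (Fin n) ℝ *ᵥ (e l).ofLp) = 0 := fun i l => by
    have := hej i l
    rw [inner_eq] at this
    simpa [toLpLin_apply] using this
  have hJJ : ∀ x y, (J (Fin n) ℝ *ᵥ x) ⬝ᵥ (J (Fin n) ℝ *ᵥ y) = x ⬝ᵥ y := fun x y => by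
    rw [dotProduct_mulVec, ← mulVec_transpose, J_transpose, neg_mulVec, mulVec_mulVec, hJ2]
    simp [neg_mulVec]
  have hPJe : ∀ i, P *ᵥ (J (Fin n) ℝ *ᵥ (e i).ofLp) = (s i)⁻¹ • (J (Fin n) ℝ *ᵥ (e i).ofLp) := by
    intro i
    rw [eq_inv_smul_iff₀ (by linarith [hs i]), ← mulVec_smul, ← mulVec_smul, ← he', mulVec_mulVec,
      mulVec_mulVec, hPJ]
  -- The columns are the eigenframe followed by its image under `J`.
  let c : Fin n ⊕ Fin n → Space n :=
    Sum.elim (fun i => (e i).ofLp) fun i => J (Fin n) ℝ *ᵥ (e i).ofLp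
  let U : Matrix (Fin n ⊕ Fin n) (Fin n ⊕ Fin n) ℝ := of fun p q => c q p
  have hmul : ∀ (A : Matrix (Fin n ⊕ Fin n) (Fin n ⊕ Fin n) ℝ) p q, (A * U) p q = (A *ᵥ c q) p :=
    fun A p q => rfl
  have hUU : Uᵀ * U = 1 := by
    ext p q
    have : (Uᵀ * U) p q = c p ⬝ᵥ c q := rfl
    rw [this, one_apply]
    rcases p with i | i <;> rcases q with l | l
    · simp [c, heo']
    · simp [c, hej']
    · simp [c, dotProduct_comm, hej']
    · simp [c, hJJ, heo']
  have hUJ : J (Fin n) ℝ * U = U * J (Fin n) ℝ := by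
    ext p q
    rw [hmul]
    rcases q with l | l
    · simp [c, U, mul_apply, J, fromBlocks, one_apply]
    · simp only [c, Sum.elim_inr, mulVec_mulVec, hJ2]
      simp [c, U, mul_apply, J, fromBlocks, neg_mulVec, one_apply]
  refine ⟨U, ⟨?_, hUU⟩, s, hs, ?_⟩
  · rw [SymplecticGroup.mem_iff, ← hUJ, Matrix.mul_assoc, mul_eq_one_comm.1 hUU, Matrix.mul_one]
  · ext p q
    rw [hmul, hyperbolic, mul_diagonal]
    rcases q with l | l
    · simp [c, U, he', mul_comm]
    · simp [c, U, hPJe, mul_comm]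

/-- The Cartan decomposition `G = V diag(t, t⁻¹) U⁻¹` of a symplectic matrix, with `1 ≤ t`. It is
obtained from a diagonalization of `Gᵀ G`. -/
theorem exists_cartan_decomposition {n : ℕ} {G : Matrix (Fin n ⊕ Fin n) (Fin n ⊕ Fin n) ℝ}
    (hG : G ∈ symplecticGroup (Fin n) ℝ) :
    ∃ U ∈ orthogonalSymplectic n, ∃ V ∈ orthogonalSymplectic n, ∃ t : Fin n → ℝ,
      (∀ i, 1 ≤ t i) ∧ G * U = V * hyperbolic t := by
  have hinj : Function.Injective G.mulVec :=
    mulVec_injective_iff_isUnit.2 ((isUnit_iff_isUnit_det _).2 (SymplecticGroup.symplectic_det hG))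
  have hP : (Gᵀ * G).PosDef := by
    simpa using PosDef.conjTranspose_mul_self G hinj
  obtain ⟨U, hU, s, hs, hPU⟩ :=
    exists_diagonalization hP (mul_mem (SymplecticGroup.transpose_mem hG) hG)
  let t : Fin n → ℝ := fun i => √(s i)
  have ht : ∀ i, 1 ≤ t i := fun i => Real.one_le_sqrt.2 (hs i)
  have ht0 : ∀ i, t i ≠ 0 := fun i => by linarith [ht i]
  have hti : t⁻¹ * t = 1 := by ext i; simp [ht0]
  have hts : t⁻¹ * (s * t⁻¹) = 1 := by
    ext i
    have : s i = t i * t i := (Real.mul_self_sqrt (by linarith [hs i])).symm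
    simp only [Pi.mul_apply, Pi.inv_apply, Pi.one_apply, this]
    field_simp [ht0 i]
  have hdt : ∀ r : Fin n → ℝ, (hyperbolic r)ᵀ = hyperbolic r := fun r => diagonal_transpose _
  refine ⟨U, hU, G * U * hyperbolic t⁻¹, ⟨?_, ?_⟩, t, ht, ?_⟩
  · exact mul_mem (mul_mem hG hU.1) (hyperbolic_mem fun i => by simp [ht0])
  · calc (G * U * hyperbolic t⁻¹)ᵀ * (G * U * hyperbolic t⁻¹)
        = hyperbolic t⁻¹ * (Uᵀ * (Gᵀ * G * U)) * hyperbolic t⁻¹ := by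
          simp only [transpose_mul, hdt, Matrix.mul_assoc]
      _ = 1 := by
          rw [hPU, ← Matrix.mul_assoc Uᵀ, hU.2, Matrix.one_mul, Matrix.mul_assoc, hyperbolic_mul,
            hyperbolic_mul, hts, hyperbolic_one]
  · rw [Matrix.mul_assoc, hyperbolic_mul, hti, hyperbolic_one, Matrix.mul_one]

/-! ### The area form on the values -/

/-- The standard area form on `ℂ = ℝ²`: the determinant of `(a, b)` in the basis `1, i`. -/
def areaForm (a b : ℂ) : ℝ := a.re * b.im - a.im * b.re

theorem continuous_areaForm : Continuous fun p : ℂ × ℂ => areaForm p.1 p.2 := by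
  unfold areaForm; fun_prop

theorem abs_areaForm_le (a b : ℂ) : |areaForm a b| ≤ 2 * (‖a‖ * ‖b‖) := by
  unfold areaForm
  have h1 := mul_le_mul (Complex.abs_re_le_norm a) (Complex.abs_im_le_norm b) (abs_nonneg _)
    (norm_nonneg _)
  have h2 := mul_le_mul (Complex.abs_im_le_norm a) (Complex.abs_re_le_norm b) (abs_nonneg _)
    (norm_nonneg _)
  rw [← abs_mul] at h1 h2
  linarith [abs_sub (a.re * b.im) (a.im * b.re)]

theorem areaForm_smul (p q : ℝ) (a b : ℂ) :
    areaForm (p • a) (q • b) = p * q * areaForm a b := by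
  simp [areaForm]; ring

theorem slMap_apply (h : SL2) (z : ℂ) :
    slMap h z = ⟨h.1 0 0 * z.re + h.1 0 1 * z.im, h.1 1 0 * z.re + h.1 1 1 * z.im⟩ := by
  change Matrix.toLin Complex.basisOneI Complex.basisOneI h.1 z = _
  rw [toLin_apply]
  apply Complex.ext <;> simp [Matrix.mulVec, dotProduct, Fin.sum_univ_two]

theorem areaForm_slMap (h : SL2) (a b : ℂ) :
    areaForm (slMap h a) (slMap h b) = areaForm a b := by
  have hd := h.2
  rw [det_fin_two] at hd
  simp only [areaForm, slMap_apply]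
  linear_combination (a.re * b.im - a.im * b.re) * hd

/-- Cramer's rule in the plane. -/
theorem areaForm_smul_eq (a b c : ℂ) :
    areaForm a b • c = areaForm c b • a + areaForm a c • b := by
  apply Complex.ext <;> simp [areaForm] <;> ring

/-- `SL(2,ℝ)` acts transitively on the pairs of vectors of the plane that span a given non-zero
area. -/
theorem exists_slMap_eq {a b a' b' : ℂ} (h0 : areaForm a b ≠ 0)
    (h : areaForm a' b' = areaForm a b) : ∃ g : SL2, slMap g a = a' ∧ slMap g b = b' := by
  set d := areaForm a b with hd
  unfold areaForm at h hd
  have hdet : (!![(a'.re * b.im - b'.re * a.im) / d, (b'.re * a.re - a'.re * b.re) / d;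
      (a'.im * b.im - b'.im * a.im) / d, (b'.im * a.re - a'.im * b.re) / d]).det = 1 := by
    rw [det_fin_two_of, div_mul_div_comm, div_mul_div_comm, ← sub_div,
      div_eq_one_iff_eq (mul_ne_zero h0 h0)]
    linear_combination (a.re * b.im - a.im * b.re) * h - d * hd
  let g : SL2 := ⟨_, hdet⟩
  refine ⟨g, ?_, ?_⟩
  all_goals
    rw [slMap_apply]
    apply Complex.ext <;> simp only [g, of_apply, cons_val', cons_val_zero, cons_val_one,
      cons_val_fin_one, div_mul_eq_mul_div, ← add_div] <;> rw [div_eq_iff h0, hd] <;> ring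

/-! ### Forms on Lagrangian frames -/

theorem symplecticForm_apply {n : ℕ} (x y : Space n) :
    symplecticForm n ![x, y] = -(x ⬝ᵥ J (Fin n) ℝ *ᵥ y) := by
  change ∑ i : Fin n, (x (Sum.inl i) * y (Sum.inr i) - x (Sum.inr i) * y (Sum.inl i)) = _
  have hJ : ∀ z : Space n, J (Fin n) ℝ *ᵥ z =
      Sum.elim (fun i => - z (Sum.inr i)) (fun i => z (Sum.inl i)) := fun z => by
    rw [J, fromBlocks_mulVec]
    simp only [zero_mulVec, neg_mulVec, one_mulVec, zero_add, add_zero]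
    rfl
  rw [hJ]
  simp [dotProduct, Finset.sum_sub_distrib]
  ring

theorem symplecticForm_mulVec {n : ℕ} {V : Matrix (Fin n ⊕ Fin n) (Fin n ⊕ Fin n) ℝ}
    (hV : V ∈ symplecticGroup (Fin n) ℝ) (x y : Space n) :
    symplecticForm n ![V *ᵥ x, V *ᵥ y] = symplecticForm n ![x, y] := by
  rw [symplecticForm_apply, symplecticForm_apply, dotProduct_comm, dotProduct_mulVec,
    ← mulVec_transpose, mulVec_mulVec, mulVec_mulVec, SymplecticGroup.mem_iff'.1 hV,
    dotProduct_comm]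

/-- A form in `𝒰(n)` is non-zero on every basis of every Lagrangian subspace. -/
theorem apply_ne_zero_of_isotropic {n : ℕ} {Ω : Form n} (hΩ : Ω ∈ U n) {u : Fin n → Space n}
    (hu : LinearIndependent ℝ u) (hiso : ∀ i j, symplecticForm n ![u i, u j] = 0) : Ω u ≠ 0 := by
  intro h0
  let L := Submodule.span ℝ (Set.range u)
  have hL : IsLagrangian L := by
    refine ⟨by simpa using finrank_span_eq_card hu, fun x hx y hy => ?_⟩
    rw [symplecticForm_apply, neg_eq_zero]
    have hiso' : ∀ i j, u i ⬝ᵥ J (Fin n) ℝ *ᵥ u j = 0 := fun i j => by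
      simpa [symplecticForm_apply] using hiso i j
    induction hx using Submodule.span_induction with
    | zero => simp
    | add a b _ _ ha hb => rw [add_dotProduct, ha, hb, add_zero]
    | smul c a _ ha => rw [smul_dotProduct, ha, smul_zero]
    | mem x hx =>
      obtain ⟨i, rfl⟩ := hx
      induction hy using Submodule.span_induction with
      | zero => simp
      | add a b _ _ ha hb => rw [mulVec_add, dotProduct_add, ha, hb, add_zero]
      | smul c a _ ha => rw [mulVec_smul, dotProduct_smul, ha, smul_zero]
      | mem y hy =>
        obtain ⟨l, rfl⟩ := hy
        exact hiso' i l
  refine hΩ.2 L hL ?_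
  let b : Module.Basis (Fin n) ℝ L := Module.Basis.span hu
  have key : (Ω.compContinuousLinearMap L.subtypeL).toAlternatingMap = 0 := by
    refine Module.Basis.ext_alternating b fun v hv => ?_
    let σ : Equiv.Perm (Fin n) := Equiv.ofBijective v (Finite.injective_iff_bijective.1 hv)
    have : (fun i => b (v i)) = (fun i => b i) ∘ σ := rfl
    rw [this, AlternatingMap.map_perm]
    have hb : (Ω.compContinuousLinearMap L.subtypeL).toAlternatingMap (fun i => b i) = Ω u := by
      change Ω (fun i => ((b i : L) : Space n)) = Ω u
      congr 1
      funext i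
      exact congrArg Subtype.val (Module.Basis.span_apply hu i)
    rw [hb, h0]; simp
  exact ContinuousAlternatingMap.toAlternatingMap_injective key

/-- The standard Lagrangian frame `∂/∂x_1, …, ∂/∂x_n`. -/
def xFrame (n : ℕ) (i : Fin n) : Space n := Pi.single (Sum.inl i) 1

/-- The complementary standard Lagrangian frame `∂/∂y_1, …, ∂/∂y_n`. -/
def yFrame (n : ℕ) (i : Fin n) : Space n := Pi.single (Sum.inr i) 1

/-- Replacing the `j`-th vector of the symplectic image of the `x`-frame by a non-trivial
combination of `V ∂/∂x_j` and `V ∂/∂y_j` gives another Lagrangian frame. -/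
theorem apply_update_ne_zero {n : ℕ} {Ω : Form n} (hΩ : Ω ∈ U n)
    {V : Matrix (Fin n ⊕ Fin n) (Fin n ⊕ Fin n) ℝ} (hV : V ∈ symplecticGroup (Fin n) ℝ)
    (j : Fin n) {p q : ℝ} (hpq : p ≠ 0 ∨ q ≠ 0) :
    Ω (Function.update (fun i => V *ᵥ xFrame n i) j
      (p • V *ᵥ xFrame n j + q • V *ᵥ yFrame n j)) ≠ 0 := by
  -- The frame consists of vectors `α i ∂/∂x_i + β i ∂/∂y_i`, one in each coordinate plane.
  let α : Fin n → ℝ := Function.update 1 j p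
  let β : Fin n → ℝ := Pi.single j q
  let w : Fin n → Space n := fun i => Sum.elim (Pi.single i (α i)) (Pi.single i (β i))
  have hαβ : ∀ i, α i ≠ 0 ∨ β i ≠ 0 := fun i => by
    by_cases h : i = j
    · subst h; simpa [α, β] using hpq
    · left; simp [α, h]
  have hw : Function.update (fun i => V *ᵥ xFrame n i) j
      (p • V *ᵥ xFrame n j + q • V *ᵥ yFrame n j) = fun i => V *ᵥ w i := by
    funext i
    by_cases h : i = j
    · subst h
      rw [Function.update_self, ← mulVec_smul, ← mulVec_smul, ← mulVec_add]
      congr 1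
      ext (l | l) <;> by_cases hl : l = i <;> simp [w, α, β, xFrame, yFrame, Pi.single_apply, hl]
    · rw [Function.update_of_ne h]
      congr 1
      ext (l | l) <;> simp [w, α, β, xFrame, Pi.single_apply, h]
  rw [hw]
  refine apply_ne_zero_of_isotropic hΩ ?_ fun i l => ?_
  · have hinj : Function.Injective V.mulVec :=
      mulVec_injective_iff_isUnit.2
        ((isUnit_iff_isUnit_det _).2 (SymplecticGroup.symplectic_det hV))
    have hlin : LinearIndependent ℝ w := by
      rw [Fintype.linearIndependent_iff]
      intro c hc i
      have h1 := congrFun hc (Sum.inl i)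
      have h2 := congrFun hc (Sum.inr i)
      simp only [w, Finset.sum_apply, Pi.smul_apply, Sum.elim_inl, Sum.elim_inr, Pi.single_apply,
        smul_eq_mul, mul_ite, mul_zero, Finset.sum_ite_eq, Finset.mem_univ, if_true,
        Pi.zero_apply, mul_eq_zero] at h1 h2
      rcases hαβ i with h | h
      · exact h1.resolve_right h
      · exact h2.resolve_right h
    exact hlin.map' V.mulVecLin (LinearMap.ker_eq_bot.2 hinj)
  · rw [symplecticForm_mulVec hV]
    change ∑ k : Fin n, (w i (Sum.inl k) * w l (Sum.inr k) - w i (Sum.inr k) * w l (Sum.inl k)) = 0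
    refine Finset.sum_eq_zero fun k _ => ?_
    by_cases h1 : k = i
    · by_cases h2 : k = l
      · subst h1; subst h2; simp [w, mul_comm]
      · simp [w, Pi.single_apply, h2]
    · simp [w, Pi.single_apply, h1]

/-- The area spanned by the two values of `Ω` on the Lagrangian frame `V ∂/∂x_i` and on the frame
in which `V ∂/∂x_j` is replaced by `V ∂/∂y_j`. -/
noncomputable def frameArea {n : ℕ} (Ω : Form n) (V : Matrix (Fin n ⊕ Fin n) (Fin n ⊕ Fin n) ℝ)
    (j : Fin n) : ℝ :=
  areaForm (Ω fun i => V *ᵥ xFrame n i)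
    (Ω (Function.update (fun i => V *ᵥ xFrame n i) j (V *ᵥ yFrame n j)))

/-- Non-vanishing on a whole pencil of Lagrangian subspaces forces the two values of `Ω` to be
linearly independent over `ℝ`. -/
theorem frameArea_ne_zero {n : ℕ} {Ω : Form n} (hΩ : Ω ∈ U n)
    {V : Matrix (Fin n ⊕ Fin n) (Fin n ⊕ Fin n) ℝ} (hV : V ∈ symplecticGroup (Fin n) ℝ)
    (j : Fin n) : frameArea Ω V j ≠ 0 := by
  intro h
  rw [frameArea] at h
  have key : ∀ p q : ℝ, Ω (Function.update (fun i => V *ᵥ xFrame n i) j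
      (p • V *ᵥ xFrame n j + q • V *ᵥ yFrame n j)) = p • (Ω fun i => V *ᵥ xFrame n i) +
      q • Ω (Function.update (fun i => V *ᵥ xFrame n i) j (V *ᵥ yFrame n j)) := fun p q => by
    rw [ContinuousAlternatingMap.map_update_add, ContinuousAlternatingMap.map_update_smul,
      ContinuousAlternatingMap.map_update_smul, Function.update_eq_self]
  set a := Ω fun i => V *ᵥ xFrame n i
  set b := Ω (Function.update (fun i => V *ᵥ xFrame n i) j (V *ᵥ yFrame n j))
  have ha : a ≠ 0 := by
    have := apply_update_ne_zero hΩ hV j (p := 1) (q := 0) (by simp)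
    rw [key] at this
    simpa using this
  unfold areaForm at h
  -- `b` is a real multiple of `a`, so a combination of the two frames is a Lagrangian frame on
  -- which `Ω` vanishes.
  by_cases hre : a.re = 0
  · have him : a.im ≠ 0 := fun him => ha (Complex.ext hre him)
    refine apply_update_ne_zero hΩ hV j (p := b.im) (q := -a.im) (by simp [him]) ?_
    rw [key]
    apply Complex.ext <;> simp <;> linarith
  · refine apply_update_ne_zero hΩ hV j (p := b.re) (q := -a.re) (by simp [hre]) ?_
    rw [key]
    apply Complex.ext <;> simp <;> linarith

theorem continuous_frameArea {n : ℕ} (Ω : Form n) (j : Fin n) :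
    Continuous fun V => frameArea Ω V j := by
  have hv : ∀ x : Space n, Continuous fun V : Matrix (Fin n ⊕ Fin n) (Fin n ⊕ Fin n) ℝ => V *ᵥ x :=
    fun x => continuous_id.matrix_mulVec continuous_const
  have h1 : Continuous fun V : Matrix (Fin n ⊕ Fin n) (Fin n ⊕ Fin n) ℝ =>
      fun i => V *ᵥ xFrame n i := continuous_pi fun i => hv _
  exact continuous_areaForm.comp
    ((Ω.cont.comp h1).prodMk (Ω.cont.comp (h1.update j (hv _))))

/-- The form `h ∘ Ω(G ·, …, G ·)`, for a matrix `G` that need not be invertible. On symplectic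
matrices it is the action of `(G⁻¹, h)`. -/
noncomputable def transform {n : ℕ} (h : SL2) (G : Matrix (Fin n ⊕ Fin n) (Fin n ⊕ Fin n) ℝ)
    (Ω : Form n) : Form n :=
  (slMap h).compContinuousAlternatingMap
    (Ω.compContinuousLinearMap (LinearMap.toContinuousLinearMap (Matrix.toLin' G)))

theorem transform_apply {n : ℕ} (h : SL2) (G : Matrix (Fin n ⊕ Fin n) (Fin n ⊕ Fin n) ℝ)
    (Ω : Form n) (v : Fin n → Space n) :
    transform h G Ω v = slMap h (Ω fun i => G *ᵥ v i) := rfl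

theorem mem_orbit_iff {n : ℕ} {Ω Ω' : Form n} :
    Ω' ∈ MulAction.orbit (Sp n × SL2) Ω ↔
      ∃ h : SL2, ∃ G ∈ symplecticGroup (Fin n) ℝ, transform h G Ω = Ω' := by
  constructor
  · rintro ⟨⟨g, h⟩, rfl⟩
    exact ⟨h, (g⁻¹ : Sp n).1, (g⁻¹ : Sp n).2, rfl⟩
  · rintro ⟨h, G, hG, rfl⟩
    refine ⟨((⟨G, hG⟩ : Sp n)⁻¹, h), ?_⟩
    change transform h (((⟨G, hG⟩ : Sp n)⁻¹⁻¹ : Sp n) : Matrix _ _ ℝ) Ω = _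
    rw [inv_inv]

/-- How the frame area changes along a Cartan decomposition: the `SL(2,ℝ)` factor drops out, and
so do `t j` and `(t j)⁻¹`, which cancel. For `n ≥ 2` what is left controls all of `t`. -/
theorem frameArea_transform {n : ℕ} (Ω : Form n) (h : SL2)
    {G U V : Matrix (Fin n ⊕ Fin n) (Fin n ⊕ Fin n) ℝ} {t : Fin n → ℝ} (ht : ∀ i, t i ≠ 0)
    (hGU : G * U = V * hyperbolic t) (j : Fin n) :
    frameArea (transform h G Ω) U j =
      (∏ i ∈ Finset.univ.erase j, t i) ^ 2 * frameArea Ω V j := by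
  have hx : ∀ i, G *ᵥ U *ᵥ xFrame n i = t i • V *ᵥ xFrame n i := fun i => by
    rw [mulVec_mulVec, hGU, ← mulVec_mulVec, ← mulVec_smul]
    congr 1
    ext p
    simp [hyperbolic, mulVec_diagonal, xFrame, Pi.single_apply]
    split_ifs with hp
    · simp [hp]
    · rfl
  have hy : ∀ i, G *ᵥ U *ᵥ yFrame n i = (t i)⁻¹ • V *ᵥ yFrame n i := fun i => by
    rw [mulVec_mulVec, hGU, ← mulVec_mulVec, ← mulVec_smul]
    congr 1
    ext p
    simp [hyperbolic, mulVec_diagonal, yFrame, Pi.single_apply]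
    split_ifs with hp
    · simp [hp]
    · rfl
  have hX : (transform h G Ω) (fun i => U *ᵥ xFrame n i) =
      slMap h ((∏ i, t i) • Ω fun i => V *ᵥ xFrame n i) := by
    rw [transform_apply, ← ContinuousAlternatingMap.map_smul_univ]
    simp only [hx]
  have hY : (transform h G Ω) (Function.update (fun i => U *ᵥ xFrame n i) j (U *ᵥ yFrame n j)) =
      slMap h ((∏ i, Function.update t j (t j)⁻¹ i) •
        Ω (Function.update (fun i => V *ᵥ xFrame n i) j (V *ᵥ yFrame n j))) := by
    rw [transform_apply, ← ContinuousAlternatingMap.map_smul_univ]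
    congr 2
    funext i
    by_cases hi : i = j
    · subst hi; simp [hy]
    · simp [hi, hx]
  rw [frameArea, hX, hY, areaForm_slMap, areaForm_smul, frameArea,
    Finset.prod_update_of_mem (Finset.mem_univ j), ← Finset.mul_prod_erase _ _ (Finset.mem_univ j),
    Finset.sdiff_singleton_eq_erase]
  field_simp [ht j]

/-! ### Properness for `n ≥ 2` -/

theorem isClosed_symplecticGroup (n : ℕ) :
    IsClosed {G : Matrix (Fin n ⊕ Fin n) (Fin n ⊕ Fin n) ℝ | G ∈ symplecticGroup (Fin n) ℝ} := by
  simp only [SymplecticGroup.mem_iff]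
  exact isClosed_eq (by fun_prop) continuous_const

theorem isCompact_symplecticGroup_inter_cube (n : ℕ) (B : ℝ) :
    IsCompact {G : Matrix (Fin n ⊕ Fin n) (Fin n ⊕ Fin n) ℝ |
      G ∈ symplecticGroup (Fin n) ℝ ∧ ∀ p q, |G p q| ≤ B} := by
  have hc : IsCompact (Set.univ.pi fun _ => Set.univ.pi fun _ => Set.Icc (-B) B :
      Set ((Fin n ⊕ Fin n) → (Fin n ⊕ Fin n) → ℝ)) :=
    isCompact_univ_pi fun _ => isCompact_univ_pi fun _ => isCompact_Icc
  refine IsCompact.of_isClosed_subset hc ((isClosed_symplecticGroup n).inter ?_) fun G hG => ?_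
  · change IsClosed {G : Matrix (Fin n ⊕ Fin n) (Fin n ⊕ Fin n) ℝ | ∀ p q, |G p q| ≤ B}
    simp only [Set.ofPred_forall]
    exact isClosed_iInter fun p => isClosed_iInter fun q =>
      isClosed_le (continuous_id.matrix_elem p q).abs continuous_const
  · exact fun p _ q _ => abs_le.1 (hG.2 p q)

theorem abs_apply_le_one {n : ℕ} {V : Matrix (Fin n ⊕ Fin n) (Fin n ⊕ Fin n) ℝ}
    (hV : V ∈ orthogonalSymplectic n) (p q : Fin n ⊕ Fin n) : |V p q| ≤ 1 :=
  entry_norm_bound_of_unitary (𝕜 := ℝ) (mem_unitaryGroup_iff'.2 hV.2) p q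

theorem isCompact_orthogonalSymplectic (n : ℕ) : IsCompact (orthogonalSymplectic n) := by
  refine ((isCompact_symplecticGroup_inter_cube n 1).inter_right
    (isClosed_eq (f := fun V => Vᵀ * V) (g := fun _ => 1) (by fun_prop)
      continuous_const)).of_isClosed_subset ?_ ?_
  · exact (isClosed_symplecticGroup n).inter (isClosed_eq (by fun_prop) continuous_const)
  · exact fun V hV => ⟨⟨hV.1, abs_apply_le_one hV⟩, hV.2⟩

/-- On the compact set of orthogonal symplectic matrices, the frame area is bounded away
from zero. -/
theorem exists_pos_le_abs_frameArea {n : ℕ} {Ω : Form n} (hΩ : Ω ∈ U n) (j : Fin n) :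
    ∃ δ > 0, ∀ V ∈ orthogonalSymplectic n, δ ≤ |frameArea Ω V j| := by
  obtain ⟨V, hV, hmin⟩ := (isCompact_orthogonalSymplectic n).exists_isMinOn
    ⟨1, one_mem _, by simp⟩ (continuous_frameArea Ω j).abs.continuousOn
  exact ⟨_, abs_pos.2 (frameArea_ne_zero hΩ hV.1 j), fun W hW => hmin hW⟩

theorem abs_frameArea_le {n : ℕ} (Ω : Form n) {U : Matrix (Fin n ⊕ Fin n) (Fin n ⊕ Fin n) ℝ}
    (hU : U ∈ orthogonalSymplectic n) (j : Fin n) : |frameArea Ω U j| ≤ 2 * (‖Ω‖ * ‖Ω‖) := by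
  have hx : ∀ i, ‖U *ᵥ xFrame n i‖ ≤ 1 := fun i => by
    rw [pi_norm_le_iff_of_nonneg zero_le_one]
    intro p
    simpa [xFrame] using abs_apply_le_one hU p (Sum.inl i)
  have hy : ∀ i, ‖U *ᵥ yFrame n i‖ ≤ 1 := fun i => by
    rw [pi_norm_le_iff_of_nonneg zero_le_one]
    intro p
    simpa [yFrame] using abs_apply_le_one hU p (Sum.inr i)
  refine (abs_areaForm_le _ _).trans ?_
  gcongr
  · exact Ω.unit_le_opNorm ((pi_norm_le_iff_of_nonneg zero_le_one).2 hx)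
  · refine Ω.unit_le_opNorm ((pi_norm_le_iff_of_nonneg zero_le_one).2 fun i => ?_)
    by_cases hi : i = j
    · subst hi; simpa using hy i
    · simpa [hi] using hx i

theorem one_le_prod_of_one_le {ι : Type*} (s : Finset ι) {t : ι → ℝ} (ht : ∀ i, 1 ≤ t i) :
    1 ≤ ∏ i ∈ s, t i :=
  Finset.prod_induction _ (1 ≤ ·) (fun _ _ => one_le_mul_of_one_le_of_one_le) le_rfl
    fun i _ => ht i

/-- Properness in the symplectic variable: for `n ≥ 2`, a bound on `h ∘ G^* Ω` bounds `G`,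
whatever `h` is. -/
theorem exists_bound_of_norm_transform_le {n : ℕ} (hn : 2 ≤ n) {Ω : Form n} (hΩ : Ω ∈ U n)
    (M : ℝ) : ∃ B : ℝ, ∀ (h : SL2) (G : Matrix (Fin n ⊕ Fin n) (Fin n ⊕ Fin n) ℝ),
      G ∈ symplecticGroup (Fin n) ℝ → ‖transform h G Ω‖ ≤ M → ∀ p q, |G p q| ≤ B := by
  choose δ hδ0 hδ using exists_pos_le_abs_frameArea hΩ
  obtain ⟨C, hC⟩ := (Set.finite_range fun j => 2 * (M * M) / δ j).bddAbove
  refine ⟨∑ _r : Fin n ⊕ Fin n, C, fun h G hG hM p q => ?_⟩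
  have hM0 : 0 ≤ M := (norm_nonneg _).trans hM
  obtain ⟨U, hU, V, hV, t, ht, hGU⟩ := exists_cartan_decomposition hG
  have ht0 : ∀ i, t i ≠ 0 := fun i => by linarith [ht i]
  have htC : ∀ m, t m ≤ C := by
    intro m
    have : Nontrivial (Fin n) := Fin.nontrivial_iff_two_le.2 hn
    -- The index `j` omitted from the product has to differ from `m`; this needs `2 ≤ n`.
    obtain ⟨j, hj⟩ := exists_ne m
    have h1 : t m ≤ ∏ i ∈ Finset.univ.erase j, t i := by
      rw [← Finset.mul_prod_erase _ _ (Finset.mem_erase.2 ⟨hj.symm, Finset.mem_univ m⟩)]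
      exact le_mul_of_one_le_right (by linarith [ht m]) (one_le_prod_of_one_le _ ht)
    have h2 : ∏ i ∈ Finset.univ.erase j, t i ≤ (∏ i ∈ Finset.univ.erase j, t i) ^ 2 :=
      le_self_pow₀ (one_le_prod_of_one_le _ ht) two_ne_zero
    have h3 : (∏ i ∈ Finset.univ.erase j, t i) ^ 2 * δ j ≤ 2 * (M * M) := by
      calc _ ≤ (∏ i ∈ Finset.univ.erase j, t i) ^ 2 * |frameArea Ω V j| := by
            gcongr; exact hδ j V hV
        _ = |frameArea (transform h G Ω) U j| := by
            rw [frameArea_transform Ω h ht0 hGU, abs_mul,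
              abs_of_nonneg (sq_nonneg (∏ i ∈ Finset.univ.erase j, t i))]
        _ ≤ 2 * (‖transform h G Ω‖ * ‖transform h G Ω‖) := abs_frameArea_le _ hU j
        _ ≤ 2 * (M * M) := by gcongr
    exact h1.trans (h2.trans (((le_div_iff₀ (hδ0 j)).2 h3).trans (hC ⟨j, rfl⟩)))
  have hG' : G = V * hyperbolic t * Uᵀ := by
    rw [← hGU, Matrix.mul_assoc, mul_eq_one_comm.1 hU.2, Matrix.mul_one]
  rw [hG', mul_apply]
  refine (Finset.abs_sum_le_sum_abs _ _).trans (Finset.sum_le_sum fun r _ => ?_)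
  rw [hyperbolic, mul_diagonal, transpose_apply, abs_mul, abs_mul]
  have hr : |Sum.elim t t⁻¹ r| ≤ C := by
    rcases r with i | i
    · simpa [abs_of_nonneg (zero_le_one.trans (ht i))] using htC i
    · have : (t i)⁻¹ ≤ 1 := inv_le_one_of_one_le₀ (ht i)
      simp only [Sum.elim_inr, Pi.inv_apply, abs_inv, abs_of_nonneg (zero_le_one.trans (ht i))]
      linarith [ht i, htC i]
  have h1 := mul_le_one₀ (abs_apply_le_one hV p r) (abs_nonneg _) (abs_apply_le_one hU q r)
  calc |V p r| * |Sum.elim t t⁻¹ r| * |U q r| = |V p r| * |U q r| * |Sum.elim t t⁻¹ r| := by ring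
    _ ≤ 1 * C := by gcongr
    _ = C := one_mul C

/-! ### Closedness of the orbits -/

/-- The `SL(2,ℝ)`-orbit of a form whose values span `ℂ` over `ℝ` is closed under pointwise limits:
the areas of pairs of values pass to the limit, and by Cramer's rule they determine the form from
two of its values. -/
theorem exists_slMap_comp_eq_of_tendsto {n : ℕ} {Ω Ω' : Form n} {v w : Fin n → Space n}
    (hvw : areaForm (Ω v) (Ω w) ≠ 0) {h : ℕ → SL2}
    (hlim : ∀ u, Tendsto (fun k => slMap (h k) (Ω u)) atTop (𝓝 (Ω' u))) :
    ∃ g : SL2, ∀ u, slMap g (Ω u) = Ω' u := by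
  have harea : ∀ u u', areaForm (Ω' u) (Ω' u') = areaForm (Ω u) (Ω u') := fun u u' => by
    have h1 := (continuous_areaForm.tendsto (Ω' u, Ω' u')).comp
      ((hlim u).prodMk_nhds (hlim u'))
    refine tendsto_nhds_unique h1 ?_
    simp only [Function.comp_def, areaForm_slMap]
    exact tendsto_const_nhds
  obtain ⟨g, hgv, hgw⟩ := exists_slMap_eq hvw (harea v w)
  refine ⟨g, fun u => smul_right_injective ℂ hvw ?_⟩
  change areaForm (Ω v) (Ω w) • slMap g (Ω u) = areaForm (Ω v) (Ω w) • Ω' u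
  rw [← map_smul, areaForm_smul_eq, map_add, map_smul, map_smul, hgv, hgw, ← harea v w,
    areaForm_smul_eq _ _ (Ω' u), harea, harea]

theorem isClosed_orbit_of_two_le {n : ℕ} (hn : 2 ≤ n) {Ω : Form n} (hΩ : Ω ∈ U n) :
    IsClosed (MulAction.orbit (Sp n × SL2) Ω) := by
  refine IsSeqClosed.isClosed fun Ψ Ω' hΨ hlim => ?_
  simp only [mem_orbit_iff] at hΨ ⊢
  choose h G hG hGΨ using hΨ
  obtain ⟨M, hM⟩ := hlim.norm.bddAbove_range
  obtain ⟨B, hB⟩ := exists_bound_of_norm_transform_le hn hΩ M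
  have hGB : ∀ k p q, |G k p q| ≤ B := fun k =>
    hB (h k) (G k) (hG k) (by rw [hGΨ]; exact hM ⟨k, rfl⟩)
  have : FirstCountableTopology (Matrix (Fin n ⊕ Fin n) (Fin n ⊕ Fin n) ℝ) :=
    inferInstanceAs (FirstCountableTopology (Fin n ⊕ Fin n → Fin n ⊕ Fin n → ℝ))
  obtain ⟨G', ⟨hG', -⟩, φ, hφ, hGlim⟩ :=
    (isCompact_symplecticGroup_inter_cube n B).tendsto_subseq fun k => ⟨hG k, hGB k⟩
  have hinv : ∀ A ∈ symplecticGroup (Fin n) ℝ, A * A⁻¹ = 1 := fun A hA =>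
    mul_nonsing_inv A (SymplecticGroup.symplectic_det hA)
  -- Along the subsequence `G → G'`, so `h ∘ Ω = Ψ (G⁻¹ ·)` converges pointwise.
  have hlim_inv : Tendsto (fun k => (G (φ k))⁻¹) atTop (𝓝 G'⁻¹) := by
    rw [SymplecticGroup.inv_eq_symplectic_inv _ hG']
    simp only [fun k => SymplecticGroup.inv_eq_symplectic_inv _ (hG k)]
    have hc : Continuous fun A : Matrix (Fin n ⊕ Fin n) (Fin n ⊕ Fin n) ℝ =>
        -J (Fin n) ℝ * Aᵀ * J (Fin n) ℝ := by fun_prop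
    exact (hc.tendsto G').comp hGlim
  have hpt : ∀ u, Tendsto (fun k => slMap (h (φ k)) (Ω u)) atTop
      (𝓝 ((transform 1 G'⁻¹ Ω') u)) := fun u => by
    have h1 : Tendsto (fun k i => (G (φ k))⁻¹ *ᵥ u i) atTop (𝓝 fun i => G'⁻¹ *ᵥ u i) := by
      have hc : Continuous fun A : Matrix (Fin n ⊕ Fin n) (Fin n ⊕ Fin n) ℝ =>
          fun i => A *ᵥ u i :=
        continuous_pi fun i => continuous_id.matrix_mulVec continuous_const
      exact (hc.tendsto _).comp hlim_inv
    have h2 := (continuous_eval.tendsto (Ω', fun i => G'⁻¹ *ᵥ u i)).comp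
      ((hlim.comp hφ.tendsto_atTop).prodMk_nhds h1)
    have h3 : (transform 1 G'⁻¹ Ω') u = Ω' fun i => G'⁻¹ *ᵥ u i := by
      rw [transform_apply]; simp [slMap]
    rw [h3]
    refine h2.congr fun k => ?_
    simp only [Function.comp_def, ← hGΨ, transform_apply, mulVec_mulVec, hinv _ (hG _), one_mulVec]
  obtain ⟨g, hg⟩ := exists_slMap_comp_eq_of_tendsto
    (frameArea_ne_zero hΩ (one_mem _) ⟨0, by omega⟩) hpt
  refine ⟨g, G', hG', ?_⟩
  ext u
  rw [transform_apply, hg, transform_apply]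
  simp [slMap, mulVec_mulVec, nonsing_inv_mul G' (SymplecticGroup.symplectic_det hG')]

theorem update_xFrame_one : Function.update (xFrame 1) 0 (yFrame 1 0) = yFrame 1 := by
  funext i
  rw [Subsingleton.elim i 0, Function.update_self]

/-- For `n = 1` a form is a linear map `ℝ² → ℂ`, hence determined by its values on the basis. -/
theorem apply_eq_of_one (Ω : Form 1) (z : Space 1) :
    (Ω fun _ => z) = z (Sum.inl 0) • Ω (xFrame 1) + z (Sum.inr 0) • Ω (yFrame 1) := by
  have hz : (fun _ => z) = Function.update (xFrame 1) 0
      (z (Sum.inl 0) • xFrame 1 0 + z (Sum.inr 0) • yFrame 1 0) := by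
    funext i
    rw [Subsingleton.elim i 0, Function.update_self]
    ext (l | l) <;> rw [Subsingleton.elim l 0] <;> simp [xFrame, yFrame]
  rw [hz, ContinuousAlternatingMap.map_update_add, ContinuousAlternatingMap.map_update_smul,
    ContinuousAlternatingMap.map_update_smul, Function.update_eq_self, update_xFrame_one]

theorem areaForm_ne_zero_of_one {Ω : Form 1} (hΩ : Ω ∈ U 1) :
    areaForm (Ω (xFrame 1)) (Ω (yFrame 1)) ≠ 0 := by
  have h := frameArea_ne_zero hΩ (one_mem _) 0
  simpa [frameArea, update_xFrame_one] using h

/-- For `n = 1` the orbit is a level set of the determinant of the linear map `Ω : ℝ² → ℂ = ℝ²`. -/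
theorem mem_orbit_iff_of_one {Ω Ω' : Form 1} (hΩ : Ω ∈ U 1) :
    Ω' ∈ MulAction.orbit (Sp 1 × SL2) Ω ↔
      areaForm (Ω' (xFrame 1)) (Ω' (yFrame 1)) = areaForm (Ω (xFrame 1)) (Ω (yFrame 1)) := by
  rw [mem_orbit_iff]
  constructor
  · rintro ⟨h, G, hG, rfl⟩
    have hω := symplecticForm_mulVec hG (xFrame 1 0) (yFrame 1 0)
    change ∑ i : Fin 1, _ = ∑ i : Fin 1, _ at hω
    simp [xFrame, yFrame] at hω
    have hx : (fun i => G *ᵥ xFrame 1 i) = fun _ => G *ᵥ xFrame 1 0 := by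
      funext i; rw [Subsingleton.elim i 0]
    have hy : (fun i => G *ᵥ yFrame 1 i) = fun _ => G *ᵥ yFrame 1 0 := by
      funext i; rw [Subsingleton.elim i 0]
    rw [transform_apply, transform_apply, areaForm_slMap, hx, hy, apply_eq_of_one,
      apply_eq_of_one Ω (G *ᵥ yFrame 1 0)]
    simp only [areaForm, xFrame, yFrame, mulVec_single_one, col_apply, Complex.add_re,
      Complex.add_im, Complex.real_smul, Complex.re_ofReal_mul, Complex.im_ofReal_mul]
    linear_combination ((Ω (xFrame 1)).re * (Ω (yFrame 1)).im -
      (Ω (xFrame 1)).im * (Ω (yFrame 1)).re) * hω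
  · intro h
    obtain ⟨g, hgx, hgy⟩ := exists_slMap_eq (areaForm_ne_zero_of_one hΩ) h
    refine ⟨g, 1, one_mem _, ?_⟩
    ext v
    have hv : v = fun _ => v 0 := by funext i; rw [Subsingleton.elim i 0]
    rw [transform_apply]
    simp only [one_mulVec]
    rw [hv, apply_eq_of_one Ω, apply_eq_of_one Ω', map_add, map_smul, map_smul, hgx, hgy]

theorem isClosed_orbit_of_one {Ω : Form 1} (hΩ : Ω ∈ U 1) :
    IsClosed (MulAction.orbit (Sp 1 × SL2) Ω) := by
  have : MulAction.orbit (Sp 1 × SL2) Ω = {Ω' |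
      areaForm (Ω' (xFrame 1)) (Ω' (yFrame 1)) = areaForm (Ω (xFrame 1)) (Ω (yFrame 1))} := by
    ext Ω'; exact mem_orbit_iff_of_one hΩ
  rw [this]
  exact isClosed_eq (continuous_areaForm.comp
    ((continuous_eval_const (xFrame 1)).prodMk (continuous_eval_const (yFrame 1))))
    continuous_const

end SympForms

/-- For `n ≥ 1`, the `Sp(2n,ℝ) × SL(2,ℝ)`-orbit of every `Ω ∈ 𝒰(n)` is closed in the
finite-dimensional real vector space `ℂ ⊗ ⋀ⁿ(ℝ²ⁿ)*`. -/
theorem mainTheorem9 (n : ℕ) (hn : 1 ≤ n) (Ω : SympForms.Form n) (hΩ : Ω ∈ SympForms.U n) :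
    IsClosed (MulAction.orbit (SympForms.Sp n × SympForms.SL2) Ω) := by
  rcases hn.eq_or_lt with rfl | hn
  · exact SympForms.isClosed_orbit_of_one hΩ
  · exact SympForms.isClosed_orbit_of_two_le hn hΩ
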